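/- Let $d\in\{1,2,3\}$, $\Omega=[-1,1]^d$, $T>0$, $Q=\Omega\times[0,T]$, let $c_1,c_2>0$ be constants and let $q\ge 0$ be an integer. Let $H^k_p(\Omega)$ be the space of $v\in L^2(\Omega)$ whose periodic weak derivatives of order at most $k$ lie in $L^2(\Omega)$, where $w$ is the periodic weak derivative $D^\alpha v$ if $\int_\Omega v\,D^\alpha\psi\,dx=(-1)^{|\alpha|}\int_\Omega w\,\psi\,dx$ for all $\psi\in C^\infty(\mathbb R^d)$ that are $2$-periodic in each coordinate. Let $g:Q\times\mathbb R\to\mathbb R$ and $f_j:Q\times\mathbb R^4\to\mathbb R$, $j=0,1,2,3$, take equal values at opposite points of opposite faces of $\Omega$ and satisfy the admissible conditions: 1. $g(x,t,y)$ is analytic in $(x,t)\in Q$ for every $y\in\mathbb R$, and there are coefficients $g^{(\ell)}$, analytic on $Q$, with $g(x,t,y)=\sum_{\ell\ge1}\frac{g^{(\ell)}(x,t)}{\ell!}y^\ell$ for all $(x,t)\in Q$, $y\in\mathbb R$. 2. There are coefficients $c_{l_0l_1l_2l_3}$, analytic on $Q$, with $f_0(x,t,\vec z)=\sum_{s\ge1}\frac1{s!}\sum_{l_0+l_1+l_2+l_3=s}c_{l_0l_1l_2l_3}(x,t)\,z_0^{l_0}z_1^{l_1}z_2^{l_2}z_3^{l_3}$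 for all $(x,t)\in Q$, $\vec z\in\mathbb R^4$, and $c_{0100}\equiv c_{0010}\equiv c_{0001}\equiv0$. 3. For $i=1,2,3$ there are $b_i$ and $b_{i,l_0l_1l_2l_3}$, analytic on $Q$, with $f_i(x,t,\vec z)=b_i(x,t)z_i+\sum_{s\ge2}\frac1{s!}\sum_{l_0+l_1+l_2+l_3=s}b_{i,l_0l_1l_2l_3}(x,t)\,z_0^{l_0}z_1^{l_1}z_2^{l_2}z_3^{l_3}$ for all $(x,t)\in Q$, $\vec z\in\mathbb R^4$, and $b_{i,l_0000}\equiv0$ for all $l_0\in\mathbb N$. 4. There are constants $L,L_0,\dots,L_3$ with $|g(x,t,y)-g(x,t,0)|\le L|y|$ and $|f_j(x,t,\vec z)-f_j(x,t,0)|\le L_j|\vec z|$ for all $(x,t)\in Q$, $y\in\mathbb R$, $\vec z\in\mathbb R^4$, $j=0,1,2,3$. Consider, with periodic boundary conditions on $\partial\Omega\times[0,T]$, the Cahn–Hilliard–Allen–Cahn system with zero initial data $$\begin{cases}\partial_t u_0=-c_1\Delta^2u_0+\Delta\big(f_0(x,t,\vec u)+g(x,t,u_0)\big)&\text{in }Q,\\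 \partial_t u_i=c_2\Delta u_i+f_i(x,t,\vec u),\quad i=1,2,3,&\text{in }Q,\\ u_j(x,0)=0,\quad j=0,1,2,3,&\text{in }\Omega.\end{cases}$$ A solution is understood in the sense of periodic distributions: $u_j$, $f_j(\cdot,\vec u)$ and $g(\cdot,u_0)$ are integrable on $Q$, and for every $\psi\in C^\infty(\mathbb R^d\times\mathbb R)$ that is $2$-periodic in each space coordinate and vanishes for $t\ge\tau$ for some $\tau<T$, $$-\int_Q u_0\,\partial_t\psi=\int_Q\Big(-c_1u_0\,\Delta^2\psi+\big(f_0(x,t,\vec u)+g(x,t,u_0)\big)\Delta\psi\Big),\qquad -\int_Q u_i\,\partial_t\psi=\int_Q\big(c_2u_i\,\Delta\psi+f_i(x,t,\vec u)\,\psi\big),\quad i=1,2,3,$$ the zero initial data being encoded by the absence of a term at $t=0$. Then, in the class $L^2(0,T;H_p^{q+4}(\Omega))\times\big(L^2(0,T;H_p^{q+2}(\Omega))\big)^3$, there exists a unique solution of this system, namely $\vec u\equiv\vec 0$; that is, $\vec 0$ is a solution and every solution $\vec u$ in this class vanishes almost everywhere in $Q$. -/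

import Mathlib

open MeasureTheory Set
open scoped ContDiff Nat

noncomputable section

namespace CHAC

/-- The space `ℝ^d` with its Euclidean norm. -/
abbrev Space (d : ℕ) := EuclideanSpace ℝ (Fin d)

/-- The values `z = (z₀, z₁, z₂, z₃)` of the four unknowns, with the Euclidean norm. -/
abbrev State := EuclideanSpace ℝ (Fin 4)

/-- The `k`-th standard basis vector of `ℝ^d`. -/
def basisVec {d : ℕ} (k : Fin d) : Space d := EuclideanSpace.single k 1

/-- The cell `Ω = [-1,1]^d`. -/
def Omega (d : ℕ) : Set (Space d) := {x | ∀ k, x k ∈ Icc (-1 : ℝ) 1}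

/-- The space-time cylinder `Q = Ω × [0,T]`; its points are pairs `(x, t)`. -/
def cylinder (d : ℕ) (T : ℝ) : Set (Space d × ℝ) := Omega d ×ˢ Icc 0 T

/-! ### Periodic Sobolev spaces -/

/-- Smooth functions on `ℝ^d` with period `2` in every coordinate. -/
structure IsPeriodicTest {d : ℕ} (ψ : Space d → ℝ) : Prop where
  smooth : ContDiff ℝ ∞ ψ
  periodic : ∀ k x, ψ (x + (2 : ℝ) • basisVec k) = ψ x

/-- `w` is the weak derivative `∂_{i₁} ⋯ ∂_{iₙ} v` of `v` on `Ω` under periodic boundary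
conditions: integration by parts against smooth periodic functions produces no boundary terms. -/
def IsPeriodicWeakDeriv {d n : ℕ} (i : Fin n → Fin d) (v w : Space d → ℝ) : Prop :=
  ∀ ψ : Space d → ℝ, IsPeriodicTest ψ →
    ∫ x in Omega d, v x * iteratedFDeriv ℝ n ψ x (fun m => basisVec (i m))
      = (-1) ^ n * ∫ x in Omega d, w x * ψ x

/-- Membership in `L²(0,T; H_p^k(Ω))`: `u` is square integrable on `Q`, and each of its spatial
weak derivatives of order at most `k` (in the periodic sense, at almost every time) is square
integrable on `Q`, so that `∫₀ᵀ ‖u(·,t)‖²_{H^k(Ω)} dt < ∞`. A derivative of order `n` is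
indexed by the tuple of the `n` directions of differentiation. -/
def MemL2Hp {d : ℕ} (T : ℝ) (k : ℕ) (u : Space d × ℝ → ℝ) : Prop :=
  MemLp u 2 (volume.restrict (cylinder d T)) ∧
  ∀ n ≤ k, ∀ i : Fin n → Fin d, ∃ w : Space d × ℝ → ℝ,
    MemLp w 2 (volume.restrict (cylinder d T)) ∧
    ∀ᵐ t ∂(volume.restrict (Icc (0 : ℝ) T)),
      IsPeriodicWeakDeriv i (fun x => u (x, t)) (fun x => w (x, t))

/-! ### Admissible nonlinearities -/

/-- Periodic boundary condition on `∂Ω × [0,T]`: equal values at opposite points of opposite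
faces of `Ω`. -/
def PeriodicOnFaces {d : ℕ} {α : Type*} (T : ℝ) (F : Space d × ℝ → α) : Prop :=
  ∀ x ∈ Omega d, ∀ t ∈ Icc 0 T, ∀ k, x k = -1 → F (x + (2 : ℝ) • basisVec k, t) = F (x, t)

/-- The degree `s` part `∑_{l₀+l₁+l₂+l₃=s} c_l z₀^{l₀} z₁^{l₁} z₂^{l₂} z₃^{l₃}` of a power series in
`z` with coefficients `c`. -/
def homogeneousPart (c : (Fin 4 → ℕ) → ℝ) (s : ℕ) (z : State) : ℝ :=
  ∑ l ∈ Finset.piAntidiag Finset.univ s, c l * ∏ j, z j ^ l j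

/-- The admissible conditions on `g(x,t,y)` and `f_j(x,t,z)`, `j = 0,1,2,3`. The index `i.succ`
with `i : Fin 3` runs through `1, 2, 3`. -/
structure Admissible {d : ℕ} (T : ℝ) (g : Space d × ℝ → ℝ → ℝ)
    (f : Fin 4 → Space d × ℝ → State → ℝ) : Prop where
  g_periodic : PeriodicOnFaces T g
  f_periodic : ∀ j, PeriodicOnFaces T (f j)
  g_analytic : ∀ y, AnalyticOn ℝ (fun p => g p y) (cylinder d T)
  g_expansion : ∃ a : ℕ → Space d × ℝ → ℝ,
    (∀ l, AnalyticOn ℝ (a l) (cylinder d T)) ∧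
    ∀ p ∈ cylinder d T, ∀ y : ℝ,
      HasSum (fun l : ℕ => a (l + 1) p / ((l + 1)! : ℝ) * y ^ (l + 1)) (g p y)
  f_zero_expansion : ∃ c : (Fin 4 → ℕ) → Space d × ℝ → ℝ,
    (∀ l, AnalyticOn ℝ (c l) (cylinder d T)) ∧
    (∀ l, ∑ j, l j = 1 → l ≠ ![1, 0, 0, 0] → ∀ p ∈ cylinder d T, c l p = 0) ∧
    ∀ p ∈ cylinder d T, ∀ z : State,
      HasSum (fun s : ℕ => 1 / ((s + 1)! : ℝ) * homogeneousPart (fun l => c l p) (s + 1) z)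
        (f 0 p z)
  f_succ_expansion : ∀ i : Fin 3,
    ∃ (b : Space d × ℝ → ℝ) (B : (Fin 4 → ℕ) → Space d × ℝ → ℝ),
      AnalyticOn ℝ b (cylinder d T) ∧
      (∀ l, AnalyticOn ℝ (B l) (cylinder d T)) ∧
      (∀ l₀ : ℕ, ∀ p ∈ cylinder d T, B ![l₀, 0, 0, 0] p = 0) ∧
      ∀ p ∈ cylinder d T, ∀ z : State,
        HasSum (fun s : ℕ => 1 / ((s + 2)! : ℝ) * homogeneousPart (fun l => B l p) (s + 2) z)
          (f i.succ p z - b p * z i.succ)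
  g_lipschitz : ∃ L : ℝ, ∀ p ∈ cylinder d T, ∀ y : ℝ, |g p y - g p 0| ≤ L * |y|
  f_lipschitz : ∀ j, ∃ L : ℝ, ∀ p ∈ cylinder d T, ∀ z : State, |f j p z - f j p 0| ≤ L * ‖z‖

/-! ### The Cahn–Hilliard–Allen–Cahn system -/

/-- Space-time test functions: smooth, `2`-periodic in every space coordinate, and zero for
times near and after `T` (no condition at `t = 0`). -/
structure IsSpaceTimeTest {d : ℕ} (T : ℝ) (ψ : Space d × ℝ → ℝ) : Prop where
  smooth : ContDiff ℝ ∞ ψ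
  periodic : ∀ k x t, ψ (x + (2 : ℝ) • basisVec k, t) = ψ (x, t)
  vanish : ∃ τ < T, ∀ x t, τ ≤ t → ψ (x, t) = 0

/-- The time derivative `∂ₜψ`. -/
def timeDeriv {d : ℕ} (ψ : Space d × ℝ → ℝ) (p : Space d × ℝ) : ℝ :=
  deriv (fun t => ψ (p.1, t)) p.2

/-- The Laplacian `Δψ` in the space variable. -/
def spaceLaplacian {d : ℕ} (ψ : Space d × ℝ → ℝ) (p : Space d × ℝ) : ℝ :=
  Laplacian.laplacian (fun x => ψ (x, p.2)) p.1

/-- The vector `(u₀, u₁, u₂, u₃)` at a point of space-time. -/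
def stateAt {d : ℕ} (u : Fin 4 → Space d × ℝ → ℝ) (p : Space d × ℝ) : State :=
  WithLp.toLp 2 (fun j => u j p)

/-- The solution class `L²(0,T; H_p^{q+4}) × L²(0,T; H_p^{q+2})³`. -/
def MemSolutionClass {d : ℕ} (T : ℝ) (q : ℕ) (u : Fin 4 → Space d × ℝ → ℝ) : Prop :=
  MemL2Hp T (q + 4) (u 0) ∧ ∀ i : Fin 3, MemL2Hp T (q + 2) (u i.succ)

/-- `u` solves, with initial data `v` and periodic boundary conditions,
`∂ₜu₀ = -c₁Δ²u₀ + Δ(f₀(x,t,u) + g(x,t,u₀))` and `∂ₜuᵢ = c₂Δuᵢ + fᵢ(x,t,u)`, `i = 1,2,3`.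
The equations are understood in the sense of periodic distributions; the initial condition
enters through the values of the test functions at `t = 0`. -/
structure IsSolution {d : ℕ} (T c₁ c₂ : ℝ) (g : Space d × ℝ → ℝ → ℝ)
    (f : Fin 4 → Space d × ℝ → State → ℝ) (v : Fin 4 → Space d → ℝ)
    (u : Fin 4 → Space d × ℝ → ℝ) : Prop where
  unknown_integrable : ∀ j, IntegrableOn (u j) (cylinder d T)
  initial_integrable : ∀ j, IntegrableOn (v j) (Omega d)
  f_integrable : ∀ j, IntegrableOn (fun p => f j p (stateAt u p)) (cylinder d T)
  g_integrable : IntegrableOn (fun p => g p (u 0 p)) (cylinder d T)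
  cahnHilliard : ∀ ψ : Space d × ℝ → ℝ, IsSpaceTimeTest T ψ →
    -(∫ p in cylinder d T, u 0 p * timeDeriv ψ p) - ∫ x in Omega d, v 0 x * ψ (x, 0)
      = ∫ p in cylinder d T, (-c₁ * (u 0 p * spaceLaplacian (spaceLaplacian ψ) p)
          + (f 0 p (stateAt u p) + g p (u 0 p)) * spaceLaplacian ψ p)
  allenCahn : ∀ i : Fin 3, ∀ ψ : Space d × ℝ → ℝ, IsSpaceTimeTest T ψ →
    -(∫ p in cylinder d T, u i.succ p * timeDeriv ψ p)
        - ∫ x in Omega d, v i.succ x * ψ (x, 0)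
      = ∫ p in cylinder d T, (c₂ * (u i.succ p * spaceLaplacian ψ p)
          + f i.succ p (stateAt u p) * ψ p)

end CHAC

end

open MeasureTheory Set
open scoped ContDiff Nat

noncomputable section

/-! All series in the admissible conditions start in positive degree, so the nonlinear terms vanish
at the zero state. Hence `0` is a solution, and the Lipschitz conditions become linear growth,
|N_j(u)| ≤ M |u|. Uniqueness of the zero solution therefore needs no comparison of two solutions: an
energy inequality for `u` itself suffices.

The functions cos(π k·x) and sin(π k·x) are periodic eigenfunctions of -Δ with eigenvalue λ =
π²|k|². Testing with such a function times a function of time turns each equation into scalar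
problems a' = -μ a + c F with a(0) = 0, where (μ, c) = (c₁λ², -λ) for the Cahn–Hilliard equation and
(c₂λ, 1) for the Allen–Cahn equations. `duhamel_of_weak` solves them. By Cauchy–Schwarz, |a(t)|² ≤ K
∫₀ᵗ |F|² with K independent of the mode: the fourth-order kernel absorbs the factor λ, since ∫ λ²
exp(-2c₁λ²s) ds ≤ 1/(2c₁), while for the other equations the kernel is at most 1.

Parseval (`exists_lintegral_sq_eq_tsum_trig`) sums the modes to ‖u_j(t)‖² ≤ K ∫₀ᵗ ‖N_j(u)‖²
(`lintegral_sq_le_of_weak`). Linear growth and summation over j bound the energy by a multiple of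
its own time integral, and Grönwall (`ae_eq_zero_of_le_lintegral`) makes it vanish. -/

namespace CHAC

/-! ### The cell as a fundamental domain of the torus -/

section TorusLift

local instance : MeasureSpace UnitAddCircle := ⟨AddCircle.haarAddCircle⟩

/-- The lift of the torus `(ℝ/ℤ)^d` to the cell `Ω`, stretched by the factor `2`. -/
def torusLift (d : ℕ) (θ : UnitAddTorus (Fin d)) : Space d :=
  WithLp.toLp 2 fun k => 2 * (AddCircle.equivIoc 1 (-1 / 2) (θ k) : ℝ)

lemma measurable_torusLift (d : ℕ) : Measurable (torusLift d) := by
  refine (WithLp.measurable_toLp 2 _).comp (measurable_pi_lambda _ fun k => ?_)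
  refine Measurable.const_mul ?_ 2
  exact measurable_subtype_coe.comp
    ((AddCircle.measurableEquivIoc 1 (-1 / 2)).measurable.comp (measurable_pi_apply k))

lemma torusLift_coe {d : ℕ} (x : Fin d → ℝ) (hx : ∀ k, x k ∈ Ioc (-1 / 2 : ℝ) (-1 / 2 + 1)) :
    torusLift d (fun k => (x k : UnitAddCircle)) = WithLp.toLp 2 ((2 : ℝ) • x) := by
  unfold torusLift
  congr 1
  funext k
  have := AddCircle.equivIoc_coe_of_mem (p := (1 : ℝ)) (hx k)
  rw [this]
  simp

lemma coe_torusLift {d : ℕ} (θ : UnitAddTorus (Fin d)) (k : Fin d) :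
    ((torusLift d θ k / 2 : ℝ) : UnitAddCircle) = θ k := by
  have : torusLift d θ k / 2 = (AddCircle.equivIoc 1 (-1 / 2) (θ k) : ℝ) := by
    simp [torusLift]
  rw [this]
  exact AddCircle.coe_equivIoc

lemma measurableSet_Omega (d : ℕ) : MeasurableSet (Omega d) := by
  have : Omega d = ⋂ k, {x : Space d | x k ∈ Icc (-1 : ℝ) 1} := by
    ext x; simp [Omega]
  rw [this]
  refine MeasurableSet.iInter fun k => measurableSet_Icc.preimage ?_
  fun_prop

lemma isCompact_Omega (d : ℕ) : IsCompact (Omega d) := by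
  have h := (isCompact_univ_pi (fun _ : Fin d => isCompact_Icc (a := (-1 : ℝ)) (b := 1))).image
    (PiLp.continuous_toLp 2 (fun _ : Fin d => ℝ))
  convert h using 1
  ext x
  constructor
  · intro hx
    exact ⟨WithLp.ofLp x, fun k _ => hx k, rfl⟩
  · rintro ⟨y, hy, rfl⟩ k
    exact hy k (mem_univ k)

/-- The cube (-1/2, 1/2]^d is a fundamental domain of the torus, dilation by 2 has Jacobian 2^d, and
the half-open cube (-1, 1]^d differs from the closed cell by a null set. -/
lemma lintegral_comp_torusLift {d : ℕ} {h : Space d → ENNReal} (hh : Measurable h) :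
    ∫⁻ θ, h (torusLift d θ)
      = ENNReal.ofReal |((2 : ℝ) ^ d)⁻¹| * ∫⁻ x in Omega d, h x := by
  have hset : MeasurableSet {x : Fin d → ℝ | ∀ i, x i ∈ Ioc (-1 / 2 : ℝ) (-1 / 2 + 1)} :=
    MeasurableSet.univ_pi' fun i => measurableSet_Ioc
  have hset' : MeasurableSet {x : Fin d → ℝ | ∀ i, x i ∈ Ioc (-1 : ℝ) 1} :=
    MeasurableSet.univ_pi' fun i => measurableSet_Ioc
  have hH : Measurable fun y : Fin d → ℝ => h (WithLp.toLp 2 y) :=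
    hh.comp (WithLp.measurable_toLp 2 _)
  rw [UnitAddTorus.lintegral_preimage _ (fun _ => (-1 / 2 : ℝ)),
    setLIntegral_congr_fun hset (fun x hx => by
      show h (torusLift d fun k => (x k : UnitAddCircle)) = _
      rw [torusLift_coe x hx])]
  calc ∫⁻ x in {x : Fin d → ℝ | ∀ i, x i ∈ Ioc (-1 / 2 : ℝ) (-1 / 2 + 1)},
        h (WithLp.toLp 2 ((2 : ℝ) • x))
      = ∫⁻ x : Fin d → ℝ, {y : Fin d → ℝ | ∀ i, y i ∈ Ioc (-1 : ℝ) 1}.indicator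
          (fun y => h (WithLp.toLp 2 y)) ((2 : ℝ) • x) := by
        rw [← lintegral_indicator hset]
        refine lintegral_congr fun x => ?_
        have hiff : (2 : ℝ) • x ∈ {y : Fin d → ℝ | ∀ i, y i ∈ Ioc (-1 : ℝ) 1} ↔
            x ∈ {x : Fin d → ℝ | ∀ i, x i ∈ Ioc (-1 / 2 : ℝ) (-1 / 2 + 1)} := by
          simp only [mem_ofPred_eq, Pi.smul_apply, smul_eq_mul, mem_Ioc]
          refine forall_congr' fun i => ?_
          constructor <;> rintro ⟨h1, h2⟩ <;> constructor <;> linarith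
        simp only [indicator, hiff]
    _ = ENNReal.ofReal |((2 : ℝ) ^ d)⁻¹| *
          ∫⁻ y in {y : Fin d → ℝ | ∀ i, y i ∈ Ioc (-1 : ℝ) 1}, h (WithLp.toLp 2 y) := by
        rw [← lintegral_map (μ := volume) (hH.indicator hset') (measurable_const_smul (2 : ℝ)),
          Measure.map_addHaar_smul _ two_ne_zero, lintegral_smul_measure,
          lintegral_indicator hset']
        simp
    _ = _ := by
        congr 1
        rw [← (PiLp.volume_preserving_toLp (Fin d)).setLIntegral_comp_preimage
          (measurableSet_Omega d) hh]
        refine setLIntegral_congr ?_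
        have h1 := Measure.univ_pi_Ioc_ae_eq_Icc (ι := Fin d) (α := fun _ => ℝ)
          (μ := fun _ => volume) (f := fun _ => (-1 : ℝ)) (g := fun _ => 1)
        rw [← volume_pi] at h1
        have h2 : {y : Fin d → ℝ | ∀ i, y i ∈ Ioc (-1 : ℝ) 1} = univ.pi fun _ => Ioc (-1 : ℝ) 1 := by
          ext x; simp
        have h3 : WithLp.toLp 2 ⁻¹' Omega d = Icc (fun _ : Fin d => (-1 : ℝ)) fun _ => 1 := by
          ext x; simp [Omega, Pi.le_def, forall_and]
        rw [h2, h3]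
        exact h1

lemma measurePreserving_torusLift (d : ℕ) :
    MeasurePreserving (torusLift d) volume
      (ENNReal.ofReal |((2 : ℝ) ^ d)⁻¹| • volume.restrict (Omega d)) := by
  refine ⟨measurable_torusLift d, Measure.ext fun s hs => ?_⟩
  have h := lintegral_comp_torusLift (d := d) (h := s.indicator 1) (measurable_one.indicator hs)
  rw [Measure.map_apply (measurable_torusLift d) hs, Measure.smul_apply, smul_eq_mul,
    ← lintegral_indicator_one hs, ← h, ← lintegral_indicator_one ((measurable_torusLift d) hs)]
  rfl

end TorusLift

/-! ### Periodic eigenfunctions of the Laplacian -/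

/-- The linear phase `x ↦ π k · x`. -/
def phase {d : ℕ} (k : Fin d → ℤ) : Space d →L[ℝ] ℝ :=
  ∑ j, (Real.pi * k j) • EuclideanSpace.proj j

lemma phase_apply {d : ℕ} (k : Fin d → ℤ) (x : Space d) :
    phase k x = ∑ j, Real.pi * k j * x j := by
  simp [phase]

/-- The real trigonometric functions `cos (π k · x)` and `sin (π k · x)`. -/
def trig {d : ℕ} (i : (Fin d → ℤ) × Bool) (x : Space d) : ℝ :=
  bif i.2 then Real.sin (phase i.1 x) else Real.cos (phase i.1 x)

lemma contDiff_trig {d : ℕ} (i : (Fin d → ℤ) × Bool) : ContDiff ℝ ∞ (trig i) := by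
  rcases i with ⟨k, _ | _⟩
  · exact Real.contDiff_cos.comp (phase k).contDiff
  · exact Real.contDiff_sin.comp (phase k).contDiff

lemma abs_trig_le {d : ℕ} (i : (Fin d → ℤ) × Bool) (x : Space d) : |trig i x| ≤ 1 := by
  rcases i with ⟨k, _ | _⟩
  · exact Real.abs_cos_le_one _
  · exact Real.abs_sin_le_one _

lemma trig_add_two_smul {d : ℕ} (i : (Fin d → ℤ) × Bool) (k : Fin d) (x : Space d) :
    trig i (x + (2 : ℝ) • basisVec k) = trig i x := by
  have h : phase i.1 (x + (2 : ℝ) • basisVec k) = phase i.1 x + (i.1 k : ℤ) * (2 * Real.pi) := by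
    rw [map_add, map_smul, phase_apply i.1 (basisVec k)]
    simp [basisVec]
    ring
  simp only [trig, h, Real.cos_add_int_mul_two_pi, Real.sin_add_int_mul_two_pi]

/-- The eigenvalue `π² |k|²` of `-Δ` on `trig i`. -/
def eigenvalue {d : ℕ} (i : (Fin d → ℤ) × Bool) : ℝ := ∑ j, (Real.pi * i.1 j) ^ 2

lemma eigenvalue_nonneg {d : ℕ} (i : (Fin d → ℤ) × Bool) : 0 ≤ eigenvalue i :=
  Finset.sum_nonneg fun _ _ => sq_nonneg _

/-- The Hessian of h ∘ l is the rank-one form h''(l x) l ⊗ l, and the Laplacian is its trace in an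
orthonormal basis. Keeping `h` general serves sine and cosine at once. -/
lemma laplacian_comp_clm {d : ℕ} {h h' h'' : ℝ → ℝ} (hd : ∀ s, HasDerivAt h (h' s) s)
    (hd' : ∀ s, HasDerivAt h' (h'' s) s) (l : Space d →L[ℝ] ℝ) (x : Space d) :
    Laplacian.laplacian (fun x => h (l x)) x = (∑ j, l (basisVec j) ^ 2) * h'' (l x) := by
  have h1 : fderiv ℝ (fun x => h (l x)) = fun x => h' (l x) • l := by
    funext y
    exact ((hd (l y)).comp_hasFDerivAt y l.hasFDerivAt).fderiv
  have h2 : HasFDerivAt (fun x => h' (l x) • l) ((h'' (l x) • l).smulRight l) x :=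
    ((hd' (l x)).comp_hasFDerivAt x l.hasFDerivAt).smul_const l
  rw [InnerProductSpace.laplacian_eq_iteratedFDeriv_orthonormalBasis _
    (EuclideanSpace.basisFun (Fin d) ℝ)]
  simp only [iteratedFDeriv_two_apply, h1, h2.fderiv]
  simp only [EuclideanSpace.basisFun_apply, basisVec, Finset.sum_mul]
  refine Finset.sum_congr rfl fun j _ => ?_
  simp
  ring

lemma laplacian_trig {d : ℕ} (i : (Fin d → ℤ) × Bool) (x : Space d) :
    Laplacian.laplacian (trig i) x = -eigenvalue i * trig i x := by
  have hb : ∀ k : Fin d → ℤ, ∑ j, phase k (basisVec j) ^ 2 = ∑ j, (Real.pi * k j) ^ 2 := by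
    intro k
    refine Finset.sum_congr rfl fun j _ => ?_
    rw [phase_apply]
    simp [basisVec]
  rcases i with ⟨k, _ | _⟩
  · have := laplacian_comp_clm (fun s => Real.hasDerivAt_cos s)
      (fun s => (Real.hasDerivAt_sin s).neg) (phase k) x
    rw [hb] at this
    refine Eq.trans this ?_
    simp [eigenvalue, trig]
  · have := laplacian_comp_clm (fun s => Real.hasDerivAt_sin s)
      (fun s => Real.hasDerivAt_cos s) (phase k) x
    rw [hb] at this
    refine Eq.trans this ?_
    simp [eigenvalue, trig]

/-! ### Parseval's identity on the cell -/

section Parseval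

local instance : MeasureSpace UnitAddCircle := ⟨AddCircle.haarAddCircle⟩

/-- A torus coordinate is half the cell coordinate, so 2π k·θ becomes π k·x, and Euler's formula
applies. The index is -k because Fourier coefficients integrate against the conjugate character. -/
lemma mFourier_neg_torusLift {d : ℕ} (k : Fin d → ℤ) (θ : UnitAddTorus (Fin d)) :
    UnitAddTorus.mFourier (-k) θ
      = (trig (k, false) (torusLift d θ) : ℂ) - trig (k, true) (torusLift d θ) * Complex.I := by
  have h1 : UnitAddTorus.mFourier (-k) θ
      = Complex.exp (-(phase k (torusLift d θ) : ℂ) * Complex.I) := by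
    rw [phase_apply]
    simp only [UnitAddTorus.mFourier, ContinuousMap.coe_mk]
    push_cast
    rw [← Finset.sum_neg_distrib, Finset.sum_mul, Complex.exp_sum]
    refine Finset.prod_congr rfl fun j _ => ?_
    rw [← coe_torusLift θ j, fourier_coe_apply]
    congr 1
    push_cast
    simp only [Pi.neg_apply]
    push_cast
    ring
  rw [h1, Complex.exp_mul_I, Complex.cos_neg, Complex.sin_neg]
  simp [trig]
  ring

/-- As `v` is real, the cosine and sine integrals are, up to sign and scaling, the real and
imaginary parts of the complex coefficient. The change of variables contributes one Jacobian factor,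
which is then squared. -/
lemma norm_sq_mFourierCoeff_torusLift {d : ℕ} {v : Space d → ℝ}
    (hv : MemLp v 2 (volume.restrict (Omega d))) (k : Fin d → ℤ) :
    ‖UnitAddTorus.mFourierCoeff (fun θ => (v (torusLift d θ) : ℂ)) k‖ ^ 2
      = (|((2 : ℝ) ^ d)⁻¹|) ^ 2 * ((∫ x in Omega d, v x * trig (k, false) x) ^ 2
        + (∫ x in Omega d, v x * trig (k, true) x) ^ 2) := by
  have : IsFiniteMeasure (volume.restrict (Omega d)) :=
    ⟨by simpa using (isCompact_Omega d).measure_lt_top⟩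
  have hint : ∀ b, Integrable (fun x => v x * trig (k, b) x) (volume.restrict (Omega d)) := by
    intro b
    refine (hv.integrable (by norm_num)).mul_bdd (c := 1)
      (contDiff_trig _).continuous.aestronglyMeasurable ?_
    exact Filter.Eventually.of_forall fun x => abs_trig_le _ x
  have hmeas : AEStronglyMeasurable (fun x : Space d =>
      ((v x * trig (k, false) x : ℝ) : ℂ) - (v x * trig (k, true) x : ℝ) * Complex.I)
      (volume.restrict (Omega d)) :=
    ((hint false).ofReal.sub ((hint true).ofReal.mul_const _)).1
  have h1 : UnitAddTorus.mFourierCoeff (fun θ => (v (torusLift d θ) : ℂ)) k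
      = |((2 : ℝ) ^ d)⁻¹| • (((∫ x in Omega d, v x * trig (k, false) x : ℝ) : ℂ)
        - (∫ x in Omega d, v x * trig (k, true) x : ℝ) * Complex.I) := by
    rw [← integral_complex_ofReal, ← integral_complex_ofReal, ← integral_mul_const,
      ← integral_sub (hint false).ofReal ((hint true).ofReal.mul_const _)]
    have h2 := integral_smul_measure (μ := volume.restrict (Omega d)) (fun x : Space d =>
      ((v x * trig (k, false) x : ℝ) : ℂ) - (v x * trig (k, true) x : ℝ) * Complex.I)
      (ENNReal.ofReal |((2 : ℝ) ^ d)⁻¹|)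
    rw [ENNReal.toReal_ofReal (abs_nonneg _)] at h2
    rw [← h2, ← (measurePreserving_torusLift d).map_eq, integral_map
      (measurable_torusLift d).aemeasurable]
    · unfold UnitAddTorus.mFourierCoeff
      refine integral_congr_ae (Filter.Eventually.of_forall fun θ => ?_)
      simp only [mFourier_neg_torusLift]
      push_cast
      rw [smul_eq_mul]
      ring
    · rw [(measurePreserving_torusLift d).map_eq]
      exact hmeas.smul_measure _
  rw [h1, norm_smul, mul_pow, Real.norm_eq_abs, abs_abs, ← Complex.normSq_eq_norm_sq,
    Complex.normSq_apply]
  simp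
  ring

/-- **Parseval's identity** on the cell `Ω`, in terms of the real trigonometric system. -/
lemma exists_lintegral_sq_eq_tsum_trig (d : ℕ) : ∃ C : ENNReal, ∀ v : Space d → ℝ,
    MemLp v 2 (volume.restrict (Omega d)) →
      ∫⁻ x in Omega d, ‖v x‖ₑ ^ 2 = C * ∑' i, ‖∫ x in Omega d, v x * trig i x‖ₑ ^ 2 := by
  set c : ℝ := |((2 : ℝ) ^ d)⁻¹| with hc
  have hc0 : 0 < c := by positivity
  -- The factor c⁻¹ undoes the change of variables in the norm, and c² comes from the squared
  -- coefficients. The indices k and -k give the same functions up to sign; this repetition is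
  -- harmless, because the identity follows the complex sum over all k.
  refine ⟨(ENNReal.ofReal c)⁻¹ * ENNReal.ofReal (c ^ 2), fun v hv => ?_⟩
  have hmp := measurePreserving_torusLift d
  have hw : MemLp (fun θ => (v (torusLift d θ) : ℂ)) 2 (volume : Measure (UnitAddTorus (Fin d))) :=
    ((hv.smul_measure (c := ENNReal.ofReal c) ENNReal.ofReal_ne_top).comp_measurePreserving
      hmp).ofReal
  have hcoe := hw.coeFn_toLp
  have hsum := UnitAddTorus.hasSum_sq_mFourierCoeff (hw.toLp _)
  have hcoeff : ∀ k, UnitAddTorus.mFourierCoeff (hw.toLp _ : UnitAddTorus (Fin d) → ℂ) k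
      = UnitAddTorus.mFourierCoeff (fun θ => (v (torusLift d θ) : ℂ)) k := fun k =>
    integral_congr_ae (by filter_upwards [hcoe] with θ hθ; rw [hθ])
  simp only [hcoeff, norm_sq_mFourierCoeff_torusLift hv, ← hc] at hsum
  have hleft : ENNReal.ofReal (∫ θ, ‖(hw.toLp _ : UnitAddTorus (Fin d) → ℂ) θ‖ ^ 2)
      = ENNReal.ofReal c * ∫⁻ x in Omega d, ‖v x‖ₑ ^ 2 := by
    rw [ofReal_integral_eq_lintegral_ofReal ((Lp.memLp (hw.toLp _)).integrable_norm_pow two_ne_zero)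
      (Filter.Eventually.of_forall fun θ => by positivity)]
    rw [← smul_eq_mul, ← lintegral_smul_measure, ← hmp.map_eq, lintegral_map']
    · refine lintegral_congr_ae ?_
      filter_upwards [hcoe] with θ hθ
      rw [hθ, ENNReal.ofReal_pow (norm_nonneg _), ofReal_norm]
      congr 1
      simp [enorm_eq_nnnorm]
    · rw [hmp.map_eq]
      exact (hv.1.enorm.pow_const 2).smul_measure _
    · exact (measurable_torusLift d).aemeasurable
  rw [← hsum.tsum_eq, ENNReal.ofReal_tsum_of_nonneg (fun k => by positivity) hsum.summable] at hleft
  have hC0 : ENNReal.ofReal c ≠ 0 := by simpa using hc0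
  have hright : ∑' k : Fin d → ℤ, ENNReal.ofReal (c ^ 2 *
        ((∫ x in Omega d, v x * trig (k, false) x) ^ 2
          + (∫ x in Omega d, v x * trig (k, true) x) ^ 2))
      = ENNReal.ofReal (c ^ 2) * ∑' i, ‖∫ x in Omega d, v x * trig i x‖ₑ ^ 2 := by
    rw [ENNReal.tsum_prod', ← ENNReal.tsum_mul_left]
    refine tsum_congr fun k => ?_
    have hsq : ∀ r : ℝ, ENNReal.ofReal (r ^ 2) = ‖r‖ₑ ^ 2 := fun r => by
      rw [← sq_abs, ENNReal.ofReal_pow (abs_nonneg _), ← Real.norm_eq_abs, ofReal_norm]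
    rw [ENNReal.ofReal_mul (by positivity), ENNReal.ofReal_add (by positivity) (by positivity),
      tsum_bool]
    simp only [hsq]
  rw [hright] at hleft
  rw [mul_assoc, hleft, ← mul_assoc, ENNReal.inv_mul_cancel hC0 ENNReal.ofReal_ne_top, one_mul]

end Parseval

/-! ### The scalar equation of one mode -/

/-- **Cauchy–Schwarz inequality** for the integral of a product of real functions. -/
lemma enorm_integral_mul_sq_le {α : Type*} [MeasurableSpace α] {ν : Measure α} {w F : α → ℝ}
    (hw : AEMeasurable w ν) (hF : AEMeasurable F ν) :
    ‖∫ s, w s * F s ∂ν‖ₑ ^ 2 ≤ (∫⁻ s, ‖w s‖ₑ ^ 2 ∂ν) * ∫⁻ s, ‖F s‖ₑ ^ 2 ∂ν := by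
  have h := ENNReal.lintegral_mul_le_Lp_mul_Lq ν Real.HolderConjugate.two_two hw.enorm hF.enorm
  have h1 : ‖∫ s, w s * F s ∂ν‖ₑ ≤ ∫⁻ s, ‖w s‖ₑ * ‖F s‖ₑ ∂ν := by
    refine (enorm_integral_le_lintegral_enorm _).trans_eq ?_
    simp only [enorm_mul]
  have h2 := h1.trans h
  have hsq : ∀ x : ENNReal, (x ^ (1 / 2 : ℝ)) ^ 2 = x := fun x => by
    rw [← ENNReal.rpow_natCast, ← ENNReal.rpow_mul]
    norm_num
  calc ‖∫ s, w s * F s ∂ν‖ₑ ^ 2 ≤ _ := pow_le_pow_left' h2 2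
    _ = _ := by
      rw [mul_pow, hsq, hsq]
      simp only [ENNReal.rpow_two]

/-- **Duhamel's formula** for a weak solution of `a' = -μ a + G`, `a(0) = 0` on `(0,T)`. -/
lemma duhamel_of_weak {T μ : ℝ} (hT : 0 < T) {a G : ℝ → ℝ}
    (ha : IntervalIntegrable a volume 0 T) (hG : IntervalIntegrable G volume 0 T)
    (h : ∀ ζ : ℝ → ℝ, ContDiff ℝ ∞ ζ → (∃ τ < T, ∀ t, τ ≤ t → ζ t = 0) →
      -(∫ t in (0 : ℝ)..T, a t * deriv ζ t) = ∫ t in (0 : ℝ)..T, (-μ * a t + G t) * ζ t) :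
    ∀ᵐ t, t ∈ Ioo 0 T → a t = ∫ s in (0 : ℝ)..t, Real.exp (-μ * (t - s)) * G s := by
  -- Integrating factor: formally A = exp(μt) a satisfies A' = H and A(0) = 0, so the aim is A = I
  -- almost everywhere, with I the primitive of H.
  set H : ℝ → ℝ := fun t => Real.exp (μ * t) * G t with hH
  set A : ℝ → ℝ := fun t => Real.exp (μ * t) * a t with hA
  have hexp : Continuous fun t : ℝ => Real.exp (μ * t) := by fun_prop
  have hHi : IntervalIntegrable H volume 0 T := hG.continuousOn_mul hexp.continuousOn
  have hAi : IntervalIntegrable A volume 0 T := ha.continuousOn_mul hexp.continuousOn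
  set I : ℝ → ℝ := fun t => ∫ s in (0 : ℝ)..t, H s with hI
  have hIac : AbsolutelyContinuousOnInterval I 0 T :=
    hHi.absolutelyContinuousOnInterval_intervalIntegral left_mem_uIcc
  have hIi : IntervalIntegrable I volume 0 T := hIac.continuousOn.intervalIntegrable
  have key : ∀ η : ℝ → ℝ, ContDiff ℝ ∞ η → HasCompactSupport η → tsupport η ⊆ Ioo 0 T →
      ∫ t, η t • (A t - I t) = 0 := by
    intro η hη hηc hηs
    have hsupp : Function.support η ⊆ Ioc 0 T :=
      (subset_tsupport η).trans (hηs.trans Ioo_subset_Ioc_self)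
    have hloc : ∫ t, η t • (A t - I t) = ∫ t in (0 : ℝ)..T, η t * (A t - I t) := by
      rw [intervalIntegral.integral_of_le hT.le]
      refine (setIntegral_eq_integral_of_forall_compl_eq_zero fun t ht => ?_).symm
      have : η t = 0 := by
        by_contra hne
        exact ht (hsupp hne)
      simp [this]
    obtain ⟨τ, hτT, hτ⟩ : ∃ τ < T, ∀ t, τ ≤ t → η t = 0 := by
      -- Adding the point 0 keeps the set nonempty when η vanishes identically, so a last point
      -- below T exists.
      have hc : IsCompact (insert 0 (tsupport η)) := IsCompact.insert hηc 0
      obtain ⟨m, hm, hmax⟩ := hc.exists_isMaxOn ⟨0, mem_insert _ _⟩ continuousOn_id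
      have hmT : m < T := by
        rcases hm with rfl | hm
        · exact hT
        · exact (hηs hm).2
      refine ⟨(m + T) / 2, by linarith, fun t ht => ?_⟩
      by_contra hne
      have := hmax (mem_insert_of_mem _ (subset_tsupport η hne))
      simp only [id, mem_ofPred_eq] at this
      linarith
    -- Basing the primitive at T makes χ vanish near T, so exp(μt) χ is an allowed test function.
    -- Its value at 0 is unrestricted, and this is how the zero initial condition enters.
    set χ : ℝ → ℝ := fun t => ∫ s in T..t, η s with hχ
    have hχd : ∀ t, HasDerivAt χ (η t) t := fun t =>
      (hη.continuous.integral_hasStrictDerivAt T t).hasDerivAt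
    have hχ' : deriv χ = η := funext fun t => (hχd t).deriv
    have hχs : ContDiff ℝ ∞ χ :=
      contDiff_infty_iff_deriv.2 ⟨fun t => (hχd t).differentiableAt, hχ' ▸ hη⟩
    have hχ0 : ∀ t, τ ≤ t → χ t = 0 := by
      intro t ht
      refine (intervalIntegral.integral_congr fun s hs => ?_).trans intervalIntegral.integral_zero
      refine hτ s (le_trans ?_ hs.1)
      exact le_min hτT.le ht
    have hes : ContDiff ℝ ∞ fun t : ℝ => Real.exp (μ * t) := by fun_prop
    have hζ := h (fun t => Real.exp (μ * t) * χ t) (hes.mul hχs)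
      ⟨τ, hτT, fun t ht => by simp [hχ0 t ht]⟩
    have hζ' : ∀ t, deriv (fun t => Real.exp (μ * t) * χ t) t
        = μ * Real.exp (μ * t) * χ t + Real.exp (μ * t) * η t := by
      intro t
      have h1 : HasDerivAt (fun t => Real.exp (μ * t)) (Real.exp (μ * t) * (μ * 1)) t :=
        ((hasDerivAt_id t).const_mul μ).exp
      refine (h1.mul (hχd t)).deriv.trans ?_
      ring
    have hAχ : IntervalIntegrable (fun t => A t * χ t) volume 0 T :=
      hAi.mul_continuousOn hχs.continuous.continuousOn
    have hAη : IntervalIntegrable (fun t => A t * η t) volume 0 T :=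
      hAi.mul_continuousOn hη.continuous.continuousOn
    have hHχ : IntervalIntegrable (fun t => H t * χ t) volume 0 T :=
      hHi.mul_continuousOn hχs.continuous.continuousOn
    have hIη : IntervalIntegrable (fun t => I t * η t) volume 0 T :=
      hIi.mul_continuousOn hη.continuous.continuousOn
    have e1 : ∫ t in (0 : ℝ)..T, a t * deriv (fun t => Real.exp (μ * t) * χ t) t
        = μ * (∫ t in (0 : ℝ)..T, A t * χ t) + ∫ t in (0 : ℝ)..T, A t * η t := by
      rw [← intervalIntegral.integral_const_mul, ← intervalIntegral.integral_add
        (hAχ.const_mul μ) hAη]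
      refine intervalIntegral.integral_congr fun t _ => ?_
      simp only [hζ', hA]
      ring
    have e2 : ∫ t in (0 : ℝ)..T, (-μ * a t + G t) * (Real.exp (μ * t) * χ t)
        = -μ * (∫ t in (0 : ℝ)..T, A t * χ t) + ∫ t in (0 : ℝ)..T, H t * χ t := by
      rw [← intervalIntegral.integral_const_mul, ← intervalIntegral.integral_add
        (hAχ.const_mul (-μ)) hHχ]
      refine intervalIntegral.integral_congr fun t _ => ?_
      simp only [hA, hH]
      ring
    -- Integration by parts for absolutely continuous functions; the boundary terms vanish because
    -- I(0) = 0 and χ(T) = 0.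
    have e3 : ∫ t in (0 : ℝ)..T, I t * η t = -∫ t in (0 : ℝ)..T, H t * χ t := by
      have hχac : AbsolutelyContinuousOnInterval χ 0 T :=
        (hη.continuous.intervalIntegrable _ _).absolutelyContinuousOnInterval_intervalIntegral
          right_mem_uIcc
      have hp := hIac.integral_mul_deriv_eq_deriv_mul hχac
      have hI0 : I 0 = 0 := intervalIntegral.integral_same
      have hχT : χ T = 0 := intervalIntegral.integral_same
      rw [hχ', hI0, hχT] at hp
      rw [hp]
      simp only [mul_zero, zero_mul, sub_zero, zero_sub, neg_inj]
      refine intervalIntegral.integral_congr_ae ?_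
      filter_upwards [hHi.ae_hasDerivAt_integral] with t ht hmem
      rw [(ht (uIoc_subset_uIcc hmem) 0 left_mem_uIcc).deriv]
    rw [e1, e2] at hζ
    rw [hloc]
    have e4 : ∫ t in (0 : ℝ)..T, η t * (A t - I t)
        = (∫ t in (0 : ℝ)..T, A t * η t) - ∫ t in (0 : ℝ)..T, I t * η t := by
      rw [← intervalIntegral.integral_sub hAη hIη]
      refine intervalIntegral.integral_congr fun t _ => ?_
      ring
    rw [e4, e3]
    linarith
  have hloci : LocallyIntegrableOn (fun t => A t - I t) (Ioo 0 T) :=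
    (((intervalIntegrable_iff_integrableOn_Ioo_of_le hT.le).1 (hAi.sub hIi))).locallyIntegrableOn
  filter_upwards [isOpen_Ioo.ae_eq_zero_of_integral_contDiff_smul_eq_zero hloci key] with t ht hmem
  have h0 : A t = I t := sub_eq_zero.1 (ht hmem)
  have h1 : a t = Real.exp (-μ * t) * A t := by
    rw [hA]
    simp only
    rw [← mul_assoc, ← Real.exp_add]
    simp
  rw [h1, h0, hI]
  simp only
  rw [← intervalIntegral.integral_const_mul]
  refine intervalIntegral.integral_congr fun s _ => ?_
  simp only [hH]
  rw [← mul_assoc, ← Real.exp_add]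
  congr 2
  ring

/-- Smoothing and trivial bounds for the square integral of the heat kernel of one mode. -/
lemma lintegral_exp_sq_le {T μ c K t : ℝ} (hμ : 0 ≤ μ) (ht : t ∈ Icc 0 T) (hK : 0 ≤ K)
    (h : c ^ 2 ≤ 2 * μ * K ∨ c ^ 2 * T ≤ K) :
    ∫⁻ s in Ioc 0 t, ‖Real.exp (-μ * (t - s)) * c‖ₑ ^ 2 ≤ ENNReal.ofReal K := by
  have hpt : ∀ s, ‖Real.exp (-μ * (t - s)) * c‖ₑ ^ 2
      = ENNReal.ofReal (c ^ 2 * Real.exp (2 * μ * (s - t))) := fun s => by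
    rw [← ofReal_norm, ← ENNReal.ofReal_pow (norm_nonneg _), Real.norm_eq_abs, sq_abs, mul_pow,
      ← Real.exp_nat_mul, mul_comm]
    congr 3
    push_cast
    ring
  have hcont : Continuous fun s => c ^ 2 * Real.exp (2 * μ * (s - t)) := by fun_prop
  simp only [hpt]
  rw [← ofReal_integral_eq_lintegral_ofReal
      ((hcont.intervalIntegrable 0 t).1) (Filter.Eventually.of_forall fun s => by positivity),
    ← intervalIntegral.integral_of_le ht.1]
  refine ENNReal.ofReal_le_ofReal ?_
  -- Either c² is absorbed by 2μK and 2μ exp(2μ(s-t)) integrates to at most 1, or the exponential is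
  -- bounded by 1 on an interval of length at most T.
  rcases h with h | h
  · have hcont' : Continuous fun s => K * (Real.exp (2 * μ * (s - t)) * (2 * μ)) := by fun_prop
    have hle : ∫ s in (0 : ℝ)..t, c ^ 2 * Real.exp (2 * μ * (s - t))
        ≤ ∫ s in (0 : ℝ)..t, K * (Real.exp (2 * μ * (s - t)) * (2 * μ)) := by
      refine intervalIntegral.integral_mono_on ht.1 (hcont.intervalIntegrable _ _)
        (hcont'.intervalIntegrable _ _) fun s _ => ?_
      have := mul_le_mul_of_nonneg_right h (Real.exp_pos (2 * μ * (s - t))).le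
      linarith
    refine hle.trans ?_
    have hd : ∀ s, HasDerivAt (fun s => K * Real.exp (2 * μ * (s - t)))
        (K * (Real.exp (2 * μ * (s - t)) * (2 * μ))) s := fun s => by
      have h1 : HasDerivAt (fun s => 2 * μ * (s - t)) (2 * μ) s := by
        simpa using ((hasDerivAt_id s).sub_const t).const_mul (2 * μ)
      exact h1.exp.const_mul K
    rw [intervalIntegral.integral_eq_sub_of_hasDerivAt (fun s _ => hd s)
      (hcont'.intervalIntegrable _ _)]
    simp only [sub_self, mul_zero, Real.exp_zero, mul_one]
    have : 0 ≤ K * Real.exp (2 * μ * (0 - t)) := by positivity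
    linarith
  · have hle : ∫ s in (0 : ℝ)..t, c ^ 2 * Real.exp (2 * μ * (s - t))
        ≤ ∫ s in (0 : ℝ)..t, c ^ 2 := by
      refine intervalIntegral.integral_mono_on ht.1 (hcont.intervalIntegrable _ _)
        (continuous_const.intervalIntegrable _ _) fun s hs => ?_
      refine mul_le_of_le_one_right (sq_nonneg c) (Real.exp_le_one_iff.2 ?_)
      exact mul_nonpos_of_nonneg_of_nonpos (by positivity) (by linarith [hs.2])
    refine hle.trans ?_
    rw [intervalIntegral.integral_const, smul_eq_mul]
    nlinarith [ht.2, sq_nonneg c]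

/-- A weak solution of `a' = -μ a + c F`, `a(0) = 0` is bounded by the square integral of `F`,
with a constant depending only on a bound of `c² / (2 μ)` or of `c² T`. -/
lemma enorm_sq_le_of_weak {T μ c K : ℝ} (hT : 0 < T) (hμ : 0 ≤ μ) (hK : 0 ≤ K)
    (hc : c ^ 2 ≤ 2 * μ * K ∨ c ^ 2 * T ≤ K) {a F : ℝ → ℝ}
    (ha : IntegrableOn a (Icc 0 T)) (hF : IntegrableOn F (Icc 0 T))
    (h : ∀ ζ : ℝ → ℝ, ContDiff ℝ ∞ ζ → (∃ τ < T, ∀ t, τ ≤ t → ζ t = 0) →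
      -(∫ t in Icc 0 T, a t * deriv ζ t) = ∫ t in Icc 0 T, (-μ * a t + c * F t) * ζ t) :
    ∀ᵐ t ∂volume.restrict (Icc 0 T),
      ‖a t‖ₑ ^ 2 ≤ ENNReal.ofReal K * ∫⁻ s in Ioc 0 t, ‖F s‖ₑ ^ 2 := by
  have ha' : IntervalIntegrable a volume 0 T :=
    (intervalIntegrable_iff_integrableOn_Icc_of_le hT.le).2 ha
  have hF' : IntervalIntegrable F volume 0 T :=
    (intervalIntegrable_iff_integrableOn_Icc_of_le hT.le).2 hF
  simp only [integral_Icc_eq_integral_Ioc, ← intervalIntegral.integral_of_le hT.le] at h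
  have hd := duhamel_of_weak hT ha' (hF'.const_mul c) h
  rw [restrict_Ioo_eq_restrict_Icc.symm, ae_restrict_iff' measurableSet_Ioo]
  filter_upwards [hd] with t ht hmem
  rw [ht hmem, intervalIntegral.integral_of_le hmem.1.le]
  simp only [← mul_assoc]
  have hm : AEMeasurable F (volume.restrict (Ioc 0 t)) :=
    (hF.mono_set ((Ioc_subset_Ioc_right hmem.2.le).trans Ioc_subset_Icc_self)).aemeasurable
  refine (enorm_integral_mul_sq_le ?_ hm).trans ?_
  · exact Continuous.aemeasurable (by fun_prop)
  · gcongr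
    exact lintegral_exp_sq_le hμ (Ioo_subset_Icc_self hmem) hK hc

/-! ### Grönwall's inequality -/

/-- **Grönwall's inequality** for integrable functions with zero initial value. -/
lemma ae_eq_zero_of_le_lintegral {T : ℝ} {N : ℝ → ENNReal}
    (hN : AEMeasurable N (volume.restrict (Icc 0 T)))
    (hfin : ∫⁻ t in Icc 0 T, N t ≠ ⊤) {K : ℝ}
    (h : ∀ᵐ t ∂volume.restrict (Icc 0 T), N t ≤ ENNReal.ofReal K * ∫⁻ s in Ioc 0 t, N s) :
    ∀ᵐ t ∂volume.restrict (Icc 0 T), N t = 0 := by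
  wlog hK : 0 < K generalizing K
  · refine this (K := 1) ?_ one_pos
    filter_upwards [h] with t ht
    rw [ENNReal.ofReal_of_nonpos (not_lt.1 hK), zero_mul] at ht
    exact ht.trans zero_le
  set ν := volume.restrict (Icc (0 : ℝ) T) with hν
  -- The rate 2K is chosen so that, after exchanging the integrals, the tail of the weight is
  -- w(s)/(2K) and the factor K leaves a contraction by 1/2.
  set w : ℝ → ENNReal := fun t => ENNReal.ofReal (Real.exp (-(2 * K) * t)) with hw
  have hwm : Measurable w := by fun_prop
  have htail : ∀ s, ∫⁻ t in Ici s, w t ≤ ENNReal.ofReal (1 / (2 * K)) * w s := by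
    intro s
    have h1 := integrableOn_exp_mul_Ioi (a := -(2 * K)) (by linarith) s
    have h2 := integral_exp_mul_Ioi (a := -(2 * K)) (by linarith) s
    rw [setLIntegral_congr Ioi_ae_eq_Ici.symm, hw,
      ← ofReal_integral_eq_lintegral_ofReal h1
        (Filter.Eventually.of_forall fun t => (Real.exp_pos _).le), h2,
      ← ENNReal.ofReal_mul (by positivity)]
    refine (ENNReal.ofReal_le_ofReal (le_of_eq ?_))
    field_simp
  have hbound : ∫⁻ t, w t * N t ∂ν ≤ ENNReal.ofReal (1 / 2) * ∫⁻ t, w t * N t ∂ν := by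
    calc ∫⁻ t, w t * N t ∂ν
        ≤ ∫⁻ t, ∫⁻ s, ENNReal.ofReal K * ((Ici s).indicator w t * N s) ∂ν ∂ν := by
          refine lintegral_mono_ae ?_
          filter_upwards [h, ae_restrict_mem measurableSet_Icc] with t ht hmem
          have hsub : Ioc 0 t ⊆ Icc 0 T :=
            (Ioc_subset_Ioc_right hmem.2).trans Ioc_subset_Icc_self
          calc w t * N t ≤ w t * (ENNReal.ofReal K * ∫⁻ s in Ioc 0 t, N s) := by gcongr
            _ = ENNReal.ofReal K * (w t * ∫⁻ s, (Ioc 0 t).indicator N s ∂ν) := by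
                rw [lintegral_indicator measurableSet_Ioc, hν, Measure.restrict_restrict
                  measurableSet_Ioc, inter_eq_left.2 hsub]
                ring
            _ ≤ _ := by
                rw [← lintegral_const_mul' _ _ ENNReal.ofReal_ne_top,
                  ← lintegral_const_mul' _ _ ENNReal.ofReal_ne_top]
                refine lintegral_mono fun s => ?_
                refine mul_le_mul_right ?_ _
                by_cases hs : s ∈ Ioc 0 t
                · rw [indicator_of_mem hs, indicator_of_mem (show t ∈ Ici s from hs.2)]
                · simp [indicator_of_notMem hs]
      _ = ∫⁻ s, ∫⁻ t, ENNReal.ofReal K * ((Ici s).indicator w t * N s) ∂ν ∂ν := by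
          refine lintegral_lintegral_swap ?_
          refine AEMeasurable.const_mul (AEMeasurable.mul ?_ ?_) _
          · have : (Function.uncurry fun t s => (Ici s).indicator w t)
                = {p : ℝ × ℝ | p.2 ≤ p.1}.indicator fun p => w p.1 := by
              funext p
              simp [Function.uncurry, indicator]
            exact (this ▸ (hwm.comp measurable_fst).indicator
              (measurableSet_le measurable_snd measurable_fst)).aemeasurable
          · exact hN.comp_snd
      _ ≤ ∫⁻ s, ENNReal.ofReal (1 / 2) * (w s * N s) ∂ν := by
          refine lintegral_mono fun s => ?_
          rw [lintegral_const_mul' _ _ ENNReal.ofReal_ne_top,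
            lintegral_mul_const _ (hwm.indicator measurableSet_Ici),
            lintegral_indicator measurableSet_Ici]
          have h3 : ∫⁻ t in Ici s, w t ∂ν ≤ ENNReal.ofReal (1 / (2 * K)) * w s :=
            (lintegral_mono' (Measure.restrict_mono le_rfl Measure.restrict_le_self) le_rfl).trans
              (htail s)
          calc _ ≤ ENNReal.ofReal K * ((ENNReal.ofReal (1 / (2 * K)) * w s) * N s) := by gcongr
            _ = (ENNReal.ofReal K * ENNReal.ofReal (1 / (2 * K))) * (w s * N s) := by ring
            _ = _ := by
              rw [← ENNReal.ofReal_mul hK.le]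
              congr 2
              field_simp
      _ = _ := lintegral_const_mul' _ _ ENNReal.ofReal_ne_top
  -- In the extended reals x ≤ x/2 forces x = 0 only when x is finite.
  have hfinite : ∫⁻ t, w t * N t ∂ν ≠ ⊤ := by
    refine ne_top_of_le_ne_top hfin (lintegral_mono_ae ?_)
    filter_upwards [ae_restrict_mem measurableSet_Icc] with t ht
    refine mul_le_of_le_one_left zero_le ?_
    rw [hw]
    simp only [ENNReal.ofReal_le_one, Real.exp_le_one_iff]
    nlinarith [ht.1]
  have hzero : ∫⁻ t, w t * N t ∂ν = 0 := by
    by_contra hne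
    have h4 := ENNReal.mul_lt_mul_left hne hfinite
      (show ENNReal.ofReal (1 / 2) < 1 by
        rw [ENNReal.ofReal_lt_one]; norm_num)
    rw [one_mul] at h4
    exact absurd hbound (not_le.2 h4)
  filter_upwards [(lintegral_eq_zero_iff' (hwm.aemeasurable.mul hN)).1 hzero] with t ht
  rcases mul_eq_zero.1 ht with h5 | h5
  · rw [hw] at h5
    simp only [ENNReal.ofReal_eq_zero] at h5
    exact absurd h5 (not_le.2 (Real.exp_pos _))
  · exact h5

/-! ### From modes to a bound in L² of the cell -/

lemma measurableSet_cylinder (d : ℕ) (T : ℝ) : MeasurableSet (cylinder d T) :=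
  (measurableSet_Omega d).prod measurableSet_Icc

lemma isCompact_cylinder (d : ℕ) (T : ℝ) : IsCompact (cylinder d T) :=
  (isCompact_Omega d).prod isCompact_Icc

lemma isFiniteMeasure_restrict_cylinder (d : ℕ) (T : ℝ) :
    IsFiniteMeasure (volume.restrict (cylinder d T)) :=
  ⟨by simpa using (isCompact_cylinder d T).measure_lt_top⟩

lemma restrict_cylinder (d : ℕ) (T : ℝ) :
    volume.restrict (cylinder d T)
      = (volume.restrict (Omega d)).prod (volume.restrict (Icc 0 T)) := by
  rw [cylinder, Measure.volume_eq_prod, Measure.prod_restrict]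

/-- Fubini for `u` gives measurable slices and Fubini for its square gives finite norms; Parseval
can then be applied at almost every time. -/
lemma ae_memLp_slice {d : ℕ} {T : ℝ} {u : Space d × ℝ → ℝ}
    (hu : MemLp u 2 (volume.restrict (cylinder d T))) :
    ∀ᵐ t ∂volume.restrict (Icc 0 T), MemLp (fun x => u (x, t)) 2 (volume.restrict (Omega d)) := by
  have := isFiniteMeasure_restrict_cylinder d T
  have h1 := hu.integrable (by norm_num)
  have h2 := hu.integrable_sq
  rw [restrict_cylinder] at h1 h2
  filter_upwards [h1.prod_left_ae, h2.prod_left_ae] with t ht1 ht2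
  exact (memLp_two_iff_integrable_sq ht1.1).2 ht2

/-- The coefficient of `u(·,t)` with respect to `trig i`. -/
def modeCoeff {d : ℕ} (u : Space d × ℝ → ℝ) (i : (Fin d → ℤ) × Bool) (t : ℝ) : ℝ :=
  ∫ x in Omega d, u (x, t) * trig i x

lemma integrable_mul_trig_mul {d : ℕ} {T : ℝ} {u : Space d × ℝ → ℝ}
    (hu : IntegrableOn u (cylinder d T)) (i : (Fin d → ℤ) × Bool) {θ : ℝ → ℝ}
    (hθ : Continuous θ) : IntegrableOn (fun p => u p * (trig i p.1 * θ p.2)) (cylinder d T) :=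
  hu.mul_continuousOn
    (((contDiff_trig i).continuous.comp continuous_fst).mul
      (hθ.comp continuous_snd)).continuousOn (isCompact_cylinder d T)

lemma integrableOn_modeCoeff {d : ℕ} {T : ℝ} {u : Space d × ℝ → ℝ}
    (hu : IntegrableOn u (cylinder d T)) (i : (Fin d → ℤ) × Bool) :
    IntegrableOn (modeCoeff u i) (Icc 0 T) := by
  have h := integrable_mul_trig_mul hu i (continuous_const (y := (1 : ℝ)))
  rw [IntegrableOn, restrict_cylinder] at h
  simp only [mul_one] at h
  exact h.integral_prod_right

lemma setIntegral_cylinder_mul_trig {d : ℕ} {T : ℝ} {u : Space d × ℝ → ℝ}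
    (hu : IntegrableOn u (cylinder d T)) (i : (Fin d → ℤ) × Bool) {θ : ℝ → ℝ}
    (hθ : Continuous θ) :
    ∫ p in cylinder d T, u p * (trig i p.1 * θ p.2) = ∫ t in Icc 0 T, modeCoeff u i t * θ t := by
  have h := integrable_mul_trig_mul hu i hθ
  rw [IntegrableOn, restrict_cylinder] at h
  rw [restrict_cylinder, integral_prod_symm _ h]
  refine integral_congr_ae (Filter.Eventually.of_forall fun t => ?_)
  simp only [modeCoeff]
  rw [← integral_mul_const]
  simp only [mul_assoc]

/-- If all modes of `u` solve `a' = -μ a + c F`, `a(0) = 0` weakly, where `c² / (2 μ)` or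
`c² T` is bounded by `K`, then `‖u(t)‖² ≤ K ∫₀ᵗ ‖F(s)‖² ds` for almost every `t`. -/
lemma lintegral_sq_le_of_weak {d : ℕ} {T K : ℝ} (hT : 0 < T) (hK : 0 ≤ K)
    {μ c : (Fin d → ℤ) × Bool → ℝ} (hμ : ∀ i, 0 ≤ μ i)
    (hc : ∀ i, c i ^ 2 ≤ 2 * μ i * K ∨ c i ^ 2 * T ≤ K) {u F : Space d × ℝ → ℝ}
    (hu : MemLp u 2 (volume.restrict (cylinder d T)))
    (hF : MemLp F 2 (volume.restrict (cylinder d T)))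
    (h : ∀ i, ∀ ζ : ℝ → ℝ, ContDiff ℝ ∞ ζ → (∃ τ < T, ∀ t, τ ≤ t → ζ t = 0) →
      -(∫ p in cylinder d T, u p * (trig i p.1 * deriv ζ p.2))
        = ∫ p in cylinder d T, (-μ i * u p + c i * F p) * (trig i p.1 * ζ p.2)) :
    ∀ᵐ t ∂volume.restrict (Icc 0 T), ∫⁻ x in Omega d, ‖u (x, t)‖ₑ ^ 2
      ≤ ENNReal.ofReal K * ∫⁻ s in Ioc 0 t, ∫⁻ x in Omega d, ‖F (x, s)‖ₑ ^ 2 := by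
  have := isFiniteMeasure_restrict_cylinder d T
  have hui : IntegrableOn u (cylinder d T) := hu.integrable (by norm_num)
  have hFi : IntegrableOn F (cylinder d T) := hF.integrable (by norm_num)
  obtain ⟨C, hC⟩ := exists_lintegral_sq_eq_tsum_trig d
  have hmode : ∀ i, ∀ᵐ t ∂volume.restrict (Icc 0 T), ‖modeCoeff u i t‖ₑ ^ 2
      ≤ ENNReal.ofReal K * ∫⁻ s in Ioc 0 t, ‖modeCoeff F i s‖ₑ ^ 2 := by
    intro i
    refine enorm_sq_le_of_weak hT (hμ i) hK (hc i) (integrableOn_modeCoeff hui i)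
      (integrableOn_modeCoeff hFi i) fun ζ hζ hτ => ?_
    have hζ' : Continuous (deriv ζ) := hζ.continuous_deriv (by simp)
    rw [← setIntegral_cylinder_mul_trig hui i hζ', h i ζ hζ hτ]
    have h1 : ∀ t, (-μ i * modeCoeff u i t + c i * modeCoeff F i t) * ζ t
        = -μ i * (modeCoeff u i t * ζ t) + c i * (modeCoeff F i t * ζ t) := fun t => by ring
    have h2 : ∀ p : Space d × ℝ, (-μ i * u p + c i * F p) * (trig i p.1 * ζ p.2)
        = -μ i * (u p * (trig i p.1 * ζ p.2)) + c i * (F p * (trig i p.1 * ζ p.2)) :=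
      fun p => by ring
    simp only [h1, h2]
    rw [integral_add ((integrable_mul_trig_mul hui i hζ.continuous).const_mul _)
      ((integrable_mul_trig_mul hFi i hζ.continuous).const_mul _), integral_const_mul,
      integral_const_mul, setIntegral_cylinder_mul_trig hui i hζ.continuous,
      setIntegral_cylinder_mul_trig hFi i hζ.continuous, integral_add, integral_const_mul,
      integral_const_mul]
    · exact ((integrableOn_modeCoeff hui i).mul_continuousOn hζ.continuous.continuousOn
        isCompact_Icc).const_mul _
    · exact ((integrableOn_modeCoeff hFi i).mul_continuousOn hζ.continuous.continuousOn
        isCompact_Icc).const_mul _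
  -- There are countably many modes, so their exceptional null sets of times can be merged.
  filter_upwards [ae_all_iff.2 hmode, ae_memLp_slice hu, ae_restrict_mem measurableSet_Icc]
    with t ht hut hmem
  have hsub : Ioc 0 t ⊆ Icc 0 T := (Ioc_subset_Ioc_right hmem.2).trans Ioc_subset_Icc_self
  calc ∫⁻ x in Omega d, ‖u (x, t)‖ₑ ^ 2 = C * ∑' i, ‖modeCoeff u i t‖ₑ ^ 2 := hC _ hut
    _ ≤ C * ∑' i, ENNReal.ofReal K * ∫⁻ s in Ioc 0 t, ‖modeCoeff F i s‖ₑ ^ 2 := by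
        gcongr with i
        exact ht i
    _ = ENNReal.ofReal K * (C * ∫⁻ s in Ioc 0 t, ∑' i, ‖modeCoeff F i s‖ₑ ^ 2) := by
        rw [ENNReal.tsum_mul_left, lintegral_tsum fun i =>
          (((integrableOn_modeCoeff hFi i).mono_set hsub).aemeasurable.enorm.pow_const 2)]
        ring
    _ ≤ ENNReal.ofReal K * ∫⁻ s in Ioc 0 t, C * ∑' i, ‖modeCoeff F i s‖ₑ ^ 2 := by
        gcongr
        -- Only this direction is needed, and it holds without finiteness of `C`.
        exact lintegral_const_mul_le _ _
    _ = _ := by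
        congr 1
        refine lintegral_congr_ae ?_
        filter_upwards [ae_restrict_of_ae_restrict_of_subset hsub (ae_memLp_slice hF)] with s hs
        exact (hC _ hs).symm

/-! ### Separated test functions -/

lemma isSpaceTimeTest_trig_mul {d : ℕ} {T : ℝ} (i : (Fin d → ℤ) × Bool) {ζ : ℝ → ℝ}
    (hζ : ContDiff ℝ ∞ ζ) (hτ : ∃ τ < T, ∀ t, τ ≤ t → ζ t = 0) :
    IsSpaceTimeTest T (fun p : Space d × ℝ => trig i p.1 * ζ p.2) where
  smooth := ((contDiff_trig i).comp contDiff_fst).mul (hζ.comp contDiff_snd)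
  periodic k x t := by simp only [trig_add_two_smul]
  vanish := by
    obtain ⟨τ, hτT, h⟩ := hτ
    exact ⟨τ, hτT, fun x t ht => by simp only [h t ht, mul_zero]⟩

lemma timeDeriv_trig_mul {d : ℕ} (i : (Fin d → ℤ) × Bool) (ζ : ℝ → ℝ) (p : Space d × ℝ) :
    timeDeriv (fun p : Space d × ℝ => trig i p.1 * ζ p.2) p = trig i p.1 * deriv ζ p.2 := by
  unfold timeDeriv
  exact deriv_const_mul_field (v := ζ) (trig i p.1)

lemma spaceLaplacian_trig_mul {d : ℕ} (i : (Fin d → ℤ) × Bool) (ζ : ℝ → ℝ) :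
    spaceLaplacian (fun p : Space d × ℝ => trig i p.1 * ζ p.2)
      = fun p => trig i p.1 * (-eigenvalue i * ζ p.2) := by
  funext p
  have h : (fun x : Space d => trig i x * ζ p.2) = ζ p.2 • trig i := by
    funext x
    simp [mul_comm]
  unfold spaceLaplacian
  simp only
  rw [h, InnerProductSpace.laplacian_smul _ (contDiff_infty.1 (contDiff_trig i) 2).contDiffAt,
    laplacian_trig, smul_eq_mul]
  ring

/-! ### Consequences of the admissible conditions -/

section Admissible

variable {d : ℕ} {T : ℝ} {g : Space d × ℝ → ℝ → ℝ} {f : Fin 4 → Space d × ℝ → State → ℝ}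

lemma homogeneousPart_zero (c : (Fin 4 → ℕ) → ℝ) {s : ℕ} (hs : s ≠ 0) :
    homogeneousPart c s 0 = 0 := by
  refine Finset.sum_eq_zero fun l hl => ?_
  obtain ⟨j, hj⟩ : ∃ j, l j ≠ 0 := by
    by_contra! hl0
    exact hs (by simpa [hl0] using (Finset.mem_piAntidiag.1 hl).1.symm)
  rw [Finset.prod_eq_zero (Finset.mem_univ j) (by simp [hj]), mul_zero]

/-- The expansion has no constant term. Together with `Admissible.f_zero`, this turns the Lipschitz
conditions into linear growth. -/
lemma Admissible.g_zero (hadm : Admissible T g f) {p : Space d × ℝ} (hp : p ∈ cylinder d T) :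
    g p 0 = 0 := by
  obtain ⟨a, -, ha⟩ := hadm.g_expansion
  have h := ha p hp 0
  simp only [ne_eq, Nat.add_eq_zero_iff, one_ne_zero, and_false, not_false_eq_true, zero_pow,
    mul_zero] at h
  exact h.unique hasSum_zero

lemma Admissible.f_zero (hadm : Admissible T g f) (j : Fin 4) {p : Space d × ℝ}
    (hp : p ∈ cylinder d T) : f j p 0 = 0 := by
  refine Fin.cases ?_ (fun i => ?_) j
  · obtain ⟨c, -, -, hc⟩ := hadm.f_zero_expansion
    have h := hc p hp 0
    simp only [homogeneousPart_zero _ (Nat.succ_ne_zero _), mul_zero] at h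
    exact h.unique hasSum_zero
  · obtain ⟨b, B, -, -, -, hB⟩ := hadm.f_succ_expansion i
    have h := hB p hp 0
    have hs : ∀ s : ℕ, s + 2 ≠ 0 := fun s => by omega
    simp only [homogeneousPart_zero _ (hs _), mul_zero] at h
    simpa using h.unique hasSum_zero

lemma stateAt_zero (p : Space d × ℝ) : stateAt 0 p = 0 := by
  ext j
  simp [stateAt]

lemma memL2Hp_zero (T : ℝ) (k : ℕ) : MemL2Hp T k (0 : Space d × ℝ → ℝ) := by
  refine ⟨MemLp.zero, fun n _ i => ⟨0, MemLp.zero, Filter.Eventually.of_forall fun t ψ _ => ?_⟩⟩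
  simp

lemma Admissible.isSolution_zero (hadm : Admissible T g f) (c₁ c₂ : ℝ) :
    IsSolution T c₁ c₂ g f 0 0 := by
  have hf : ∀ j, ∀ p ∈ cylinder d T, f j p (stateAt 0 p) = 0 := fun j p hp => by
    rw [stateAt_zero, hadm.f_zero j hp]
  have hg : ∀ p ∈ cylinder d T, g p ((0 : Fin 4 → Space d × ℝ → ℝ) 0 p) = 0 := fun p hp =>
    hadm.g_zero hp
  refine ⟨fun j => integrable_zero _ _ _, fun j => integrable_zero _ _ _, fun j => ?_, ?_,
    fun ψ _ => ?_, fun i ψ _ => ?_⟩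
  · exact (integrableOn_congr_fun (hf j) (measurableSet_cylinder d T)).2 (integrable_zero _ _ _)
  · exact (integrableOn_congr_fun hg (measurableSet_cylinder d T)).2 (integrable_zero _ _ _)
  · refine Eq.trans (by simp)
      (setIntegral_eq_zero_of_forall_eq_zero fun p hp => ?_).symm
    rw [hf 0 p hp, hg p hp]
    simp
  · refine Eq.trans (by simp)
      (setIntegral_eq_zero_of_forall_eq_zero fun p hp => ?_).symm
    rw [hf i.succ p hp]
    simp

/-- The nonlinear terms of the four equations: `f₀ + g` in the first, `fᵢ` in the others. -/
def nonlinearity (g : Space d × ℝ → ℝ → ℝ) (f : Fin 4 → Space d × ℝ → State → ℝ)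
    (u : Fin 4 → Space d × ℝ → ℝ) (j : Fin 4) (p : Space d × ℝ) : ℝ :=
  f j p (stateAt u p) + if j = 0 then g p (u 0 p) else 0

lemma Admissible.exists_nonlinearity_le (hadm : Admissible T g f)
    (u : Fin 4 → Space d × ℝ → ℝ) :
    ∃ M : ℝ, 0 ≤ M ∧ ∀ j, ∀ p ∈ cylinder d T, |nonlinearity g f u j p| ≤ M * ‖stateAt u p‖ := by
  obtain ⟨L, hL⟩ := hadm.g_lipschitz
  choose M hM using hadm.f_lipschitz
  refine ⟨∑ j, |M j| + |L|, by positivity, fun j p hp => ?_⟩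
  have h1 : |f j p (stateAt u p)| ≤ (∑ j, |M j|) * ‖stateAt u p‖ := by
    have h := hM j p hp (stateAt u p)
    rw [hadm.f_zero j hp, sub_zero] at h
    refine h.trans (mul_le_mul_of_nonneg_right ?_ (norm_nonneg _))
    exact (le_abs_self _).trans
      (Finset.single_le_sum (f := fun j => |M j|) (fun k _ => abs_nonneg _) (Finset.mem_univ j))
  have h2 : |g p (u 0 p)| ≤ |L| * ‖stateAt u p‖ := by
    have h := hL p hp (u 0 p)
    rw [hadm.g_zero hp, sub_zero] at h
    exact h.trans (mul_le_mul (le_abs_self _) (PiLp.norm_apply_le (stateAt u p) 0)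
      (abs_nonneg _) (abs_nonneg _))
  rw [nonlinearity, add_mul]
  refine (abs_add_le _ _).trans (add_le_add h1 ?_)
  split_ifs
  · exact h2
  · simpa using mul_nonneg (abs_nonneg L) (norm_nonneg _)

/-- The growth bound in the form used by the energy estimate, with the energy density as an extended
nonnegative sum. -/
lemma enorm_nonlinearity_sq_le {M : ℝ} (u : Fin 4 → Space d × ℝ → ℝ) {j : Fin 4} {p : Space d × ℝ}
    (h : |nonlinearity g f u j p| ≤ M * ‖stateAt u p‖) :
    ‖nonlinearity g f u j p‖ₑ ^ 2 ≤ ENNReal.ofReal (M ^ 2) * ∑ k, ‖u k p‖ₑ ^ 2 := by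
  have hsq : ∀ r : ℝ, ‖r‖ₑ ^ 2 = ENNReal.ofReal (r ^ 2) := fun r => by
    rw [← sq_abs, ENNReal.ofReal_pow (abs_nonneg _), ← Real.norm_eq_abs, ofReal_norm]
  simp only [hsq]
  rw [← ENNReal.ofReal_sum_of_nonneg fun k _ => sq_nonneg _, ← ENNReal.ofReal_mul (sq_nonneg _)]
  refine ENNReal.ofReal_le_ofReal ?_
  have h1 := pow_le_pow_left₀ (abs_nonneg _) h 2
  rw [sq_abs, mul_pow, EuclideanSpace.norm_sq_eq] at h1
  simpa [stateAt] using h1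

end Admissible

/-! ### Energy estimate and uniqueness -/

section Uniqueness

variable {d : ℕ} {T : ℝ} {g : Space d × ℝ → ℝ → ℝ} {f : Fin 4 → Space d × ℝ → State → ℝ}
  {u : Fin 4 → Space d × ℝ → ℝ} {c₁ c₂ : ℝ}

/-- The `j`-th equation tested with separated functions: every mode of `u j` satisfies a scalar
linear equation, with rate and forcing factor depending on the eigenvalue. -/
lemma IsSolution.mode_equation (hsol : IsSolution T c₁ c₂ g f 0 u) (j : Fin 4)
    (i : (Fin d → ℤ) × Bool) {ζ : ℝ → ℝ} (hζ : ContDiff ℝ ∞ ζ)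
    (hτ : ∃ τ < T, ∀ t, τ ≤ t → ζ t = 0) :
    -(∫ p in cylinder d T, u j p * (trig i p.1 * deriv ζ p.2))
      = ∫ p in cylinder d T,
        (-(if j = 0 then c₁ * eigenvalue i ^ 2 else c₂ * eigenvalue i) * u j p
          + (if j = 0 then -eigenvalue i else 1) * nonlinearity g f u j p)
            * (trig i p.1 * ζ p.2) := by
  have htest := isSpaceTimeTest_trig_mul (T := T) i hζ hτ
  refine Fin.cases ?_ (fun k => ?_) j
  · have h := hsol.cahnHilliard _ htest
    -- The first Laplacian is again a separated function, with time factor -λζ, so the same formula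
    -- applies once more and gives λ².
    rw [spaceLaplacian_trig_mul, spaceLaplacian_trig_mul i (fun t => -eigenvalue i * ζ t)] at h
    simp only [timeDeriv_trig_mul, Pi.zero_apply, zero_mul, integral_zero, sub_zero] at h
    rw [h]
    refine integral_congr_ae (Filter.Eventually.of_forall fun p => ?_)
    simp only [nonlinearity, if_true]
    ring
  · have h := hsol.allenCahn k _ htest
    rw [spaceLaplacian_trig_mul] at h
    simp only [timeDeriv_trig_mul, Pi.zero_apply, zero_mul, integral_zero, sub_zero] at h
    rw [h]
    refine integral_congr_ae (Filter.Eventually.of_forall fun p => ?_)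
    simp only [nonlinearity, Fin.succ_ne_zero, if_false]
    ring

lemma IsSolution.aestronglyMeasurable_nonlinearity (hsol : IsSolution T c₁ c₂ g f 0 u)
    (j : Fin 4) :
    AEStronglyMeasurable (nonlinearity g f u j) (volume.restrict (cylinder d T)) := by
  refine (hsol.f_integrable j).1.add ?_
  split_ifs
  · exact hsol.g_integrable.1
  · exact aestronglyMeasurable_const

/-- **Uniqueness** in `L²(Q)`: a distributional solution with zero initial data vanishes. -/
theorem IsSolution.ae_eq_zero (hT : 0 < T) (hc₁ : 0 < c₁) (hc₂ : 0 < c₂)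
    (hadm : Admissible T g f) (hu : ∀ j, MemLp (u j) 2 (volume.restrict (cylinder d T)))
    (hsol : IsSolution T c₁ c₂ g f 0 u) (j : Fin 4) :
    u j =ᵐ[volume.restrict (cylinder d T)] 0 := by
  obtain ⟨M, hM0, hM⟩ := hadm.exists_nonlinearity_le u
  have hstate : MemLp (stateAt u) 2 (volume.restrict (cylinder d T)) :=
    MemLp.of_eval_piLp hu
  have hF : ∀ j, MemLp (nonlinearity g f u j) 2 (volume.restrict (cylinder d T)) := fun j =>
    hstate.of_le_mul (c := M) (hsol.aestronglyMeasurable_nonlinearity j) (by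
      filter_upwards [ae_restrict_mem (measurableSet_cylinder d T)] with p hp
      exact hM j p hp)
  -- The first summand serves the Cahn–Hilliard modes, where λ² = 2(c₁λ²)/(2c₁), including λ = 0;
  -- the second serves the Allen–Cahn modes, where the forcing factor is 1.
  set K : ℝ := 1 / (2 * c₁) + T with hKdef
  have hK : 0 ≤ K := by positivity
  set E : Space d × ℝ → ENNReal := fun p => ∑ k, ‖u k p‖ₑ ^ 2 with hE
  have hEm : AEMeasurable E (volume.restrict (cylinder d T)) :=
    Finset.aemeasurable_fun_sum _ fun k _ => (hu k).1.enorm.pow_const 2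
  have hEfin : ∫⁻ p in cylinder d T, E p ≠ ⊤ := by
    rw [hE, lintegral_finsetSum' _ fun k _ => (hu k).1.enorm.pow_const 2]
    refine ENNReal.sum_ne_top.2 fun k _ => ?_
    have h := (hu k).eLpNorm_ne_top
    have h2 := eLpNorm_nnreal_pow_eq_lintegral (f := u k) (p := 2)
      (μ := volume.restrict (cylinder d T)) two_ne_zero
    simp only [NNReal.coe_ofNat, ENNReal.coe_ofNat, ENNReal.rpow_ofNat] at h2
    exact h2 ▸ ENNReal.pow_ne_top h
  have hEm' := hEm
  rw [restrict_cylinder] at hEm hEfin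
  rw [lintegral_prod_symm _ hEm] at hEfin
  have hNm : AEMeasurable (fun t => ∫⁻ x in Omega d, E (x, t)) (volume.restrict (Icc 0 T)) :=
    hEm.prod_swap.lintegral_prod_right'
  have hbound : ∀ j, ∀ᵐ t ∂volume.restrict (Icc 0 T), ∫⁻ x in Omega d, ‖u j (x, t)‖ₑ ^ 2
      ≤ ENNReal.ofReal K * ∫⁻ s in Ioc 0 t,
        ∫⁻ x in Omega d, ‖nonlinearity g f u j (x, s)‖ₑ ^ 2 := by
    intro j
    refine lintegral_sq_le_of_weak hT hK (fun i => ?_) (fun i => ?_) (hu j) (hF j)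
      fun i ζ hζ hτ => hsol.mode_equation j i hζ hτ
    · have := eigenvalue_nonneg i
      split_ifs <;> positivity
    · split_ifs
      · left
        have h1 : 2 * (c₁ * eigenvalue i ^ 2) * K
            = eigenvalue i ^ 2 + 2 * (c₁ * eigenvalue i ^ 2) * T := by
          rw [hKdef]
          field_simp
        rw [h1, neg_sq]
        have : 0 ≤ 2 * (c₁ * eigenvalue i ^ 2) * T := by positivity
        linarith
      · right
        have : 0 ≤ 1 / (2 * c₁) := by positivity
        rw [hKdef]
        linarith
  -- The factor 4 counts the equations: each nonlinear term is bounded by the full energy density.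
  have hN : ∀ᵐ t ∂volume.restrict (Icc 0 T), ∫⁻ x in Omega d, E (x, t)
      ≤ ENNReal.ofReal (4 * K * M ^ 2) * ∫⁻ s in Ioc 0 t, ∫⁻ x in Omega d, E (x, s) := by
    filter_upwards [ae_all_iff.2 hbound, ae_all_iff.2 fun j => ae_memLp_slice (hu j),
      ae_restrict_mem measurableSet_Icc] with t ht hut hmem
    have hF' : ∀ j, ∫⁻ s in Ioc 0 t, ∫⁻ x in Omega d, ‖nonlinearity g f u j (x, s)‖ₑ ^ 2
        ≤ ENNReal.ofReal (M ^ 2) * ∫⁻ s in Ioc 0 t, ∫⁻ x in Omega d, E (x, s) := by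
      intro j
      rw [← lintegral_const_mul' _ _ ENNReal.ofReal_ne_top]
      refine setLIntegral_mono' measurableSet_Ioc fun s hs => ?_
      rw [← lintegral_const_mul' _ _ ENNReal.ofReal_ne_top]
      refine setLIntegral_mono' (measurableSet_Omega d) fun x hx => ?_
      exact enorm_nonlinearity_sq_le u (hM j (x, s) ⟨hx, hs.1.le, hs.2.trans hmem.2⟩)
    calc ∫⁻ x in Omega d, E (x, t) = ∑ j, ∫⁻ x in Omega d, ‖u j (x, t)‖ₑ ^ 2 :=
          lintegral_finsetSum' _ fun j _ => (hut j).1.enorm.pow_const 2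
      _ ≤ ∑ _j : Fin 4, ENNReal.ofReal K * (ENNReal.ofReal (M ^ 2) *
            ∫⁻ s in Ioc 0 t, ∫⁻ x in Omega d, E (x, s)) :=
          Finset.sum_le_sum fun j _ => (ht j).trans (mul_le_mul_right (hF' j) _)
      _ = _ := by
          rw [Finset.sum_const, Finset.card_univ, Fintype.card_fin, nsmul_eq_mul,
            ENNReal.ofReal_mul (by positivity), ENNReal.ofReal_mul (by positivity)]
          simp only [ENNReal.ofReal_ofNat, Nat.cast_ofNat]
          ring
  have hzero := ae_eq_zero_of_le_lintegral hNm hEfin hN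
  have hint : ∫⁻ p in cylinder d T, E p = 0 := by
    rw [restrict_cylinder, lintegral_prod_symm _ hEm, lintegral_congr_ae hzero, lintegral_zero]
  filter_upwards [(lintegral_eq_zero_iff' hEm').1 hint] with p hp
  have h := (Finset.sum_eq_zero_iff.1 hp) j (Finset.mem_univ j)
  simpa using h

end Uniqueness

end CHAC

end

theorem mainTheorem5 (d : ℕ) (hd : 1 ≤ d) (hd' : d ≤ 3) (T : ℝ) (hT : 0 < T)
    (c₁ c₂ : ℝ) (hc₁ : 0 < c₁) (hc₂ : 0 < c₂) (q : ℕ)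
    (g : CHAC.Space d × ℝ → ℝ → ℝ) (f : Fin 4 → CHAC.Space d × ℝ → CHAC.State → ℝ)
    (hadm : CHAC.Admissible T g f) :
    (CHAC.MemSolutionClass T q (0 : Fin 4 → CHAC.Space d × ℝ → ℝ) ∧
      CHAC.IsSolution T c₁ c₂ g f 0 0) ∧
    ∀ u : Fin 4 → CHAC.Space d × ℝ → ℝ,
      CHAC.MemSolutionClass T q u → CHAC.IsSolution T c₁ c₂ g f 0 u →
        ∀ j, u j =ᵐ[volume.restrict (CHAC.cylinder d T)] 0 := by
  refine ⟨⟨⟨CHAC.memL2Hp_zero _ _, fun i => CHAC.memL2Hp_zero _ _⟩,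
    hadm.isSolution_zero c₁ c₂⟩, fun u hu hsol j => ?_⟩
  refine hsol.ae_eq_zero hT hc₁ hc₂ hadm (fun j => ?_) j
  exact Fin.cases hu.1.1 (fun i => (hu.2 i).1) j
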